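/- All simplicial complexes are finite and abstract. The dimension of a face is its number of vertices minus one, and the dimension of a complex is the largest dimension of its faces. A nonempty face $\tau$ of a complex $X$ is \emph{free} if it is a proper subset of exactly one other face $\sigma$ of $X$; an \emph{elementary collapse} of $X$ removes a free face $\tau$ together with this $\sigma$. A \emph{collapsing sequence} on $X$ is a finite, possibly empty, sequence of elementary collapses starting at $X$. It \emph{gets stuck at} $Y$ if it reduces $X$ to $Y$ and $Y$ has no free face, and it \emph{gets stuck at dimension} $d$ if it gets stuck at some $d$-dimensional complex. A complex is \emph{contractible} if its geometric realization is homotopy equivalent to a point; for example, the simplex with $n \ge 1$ vertices is contractible. \textbf{Corollary.} Let $X$ be a contractible simplicial complex on $n$ vertices. If $n \ge 4$, then there is no collapsing sequence on $X$ which gets stuck at a dimension $d \ge n-3$. Moreover, for every $n$, if a collapsing sequence on $X$ gets stuck at a complex $Y$ of dimension at least $n-3$, then $Y$ is a single vertex. -/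

import Mathlib

namespace PreAbstractSimplicialComplex

/-- The vertices of `X`: the points `v` of the ground set for which `{v}` is a face. -/
def vertexSet {V : Type*} (X : PreAbstractSimplicialComplex V) : Set V :=
  {v | {v} ∈ X}

/-- `X` has dimension `d`: its largest faces have `d + 1` vertices. -/
def HasDim {V : Type*} (X : PreAbstractSimplicialComplex V) (d : ℕ) : Prop :=
  (∃ s ∈ X, s.card = d + 1) ∧ ∀ s ∈ X, s.card ≤ d + 1

/-- `X` consists of exactly one vertex. -/
def IsSingleVertex {V : Type*} (X : PreAbstractSimplicialComplex V) : Prop :=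
  ∃ v : V, ∀ s : Finset V, s ∈ X ↔ s = {v}

/-- A (nonempty) face `τ` of `X` is free if it is a proper subset of exactly one face of `X`. -/
def IsFree {V : Type*} (X : PreAbstractSimplicialComplex V) (τ : Finset V) : Prop :=
  τ ∈ X ∧ ∃! σ : Finset V, σ ∈ X ∧ τ ⊂ σ

/-- `Y` arises from `X` by an elementary collapse: the removal of a free face `τ` of `X` and of
the unique face `σ` of `X` properly containing it. -/
def ElementaryCollapse {V : Type*} (X Y : PreAbstractSimplicialComplex V) : Prop :=
  ∃ τ σ : Finset V, X.IsFree τ ∧ σ ∈ X ∧ τ ⊂ σ ∧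
    ∀ ρ : Finset V, ρ ∈ Y ↔ ρ ∈ X ∧ ρ ≠ τ ∧ ρ ≠ σ

/-- A finite (possibly empty) sequence of elementary collapses reduces `X` to `Y`. -/
def CollapsesTo {V : Type*} (X Y : PreAbstractSimplicialComplex V) : Prop :=
  Relation.ReflTransGen ElementaryCollapse X Y

/-- Some collapsing sequence on `X` gets stuck at `Y`: it reduces `X` to `Y`, and `Y` has no
free face. -/
def GetsStuckAt {V : Type*} (X Y : PreAbstractSimplicialComplex V) : Prop :=
  X.CollapsesTo Y ∧ ∀ τ : Finset V, ¬ Y.IsFree τ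

/-- Some collapsing sequence on `X` gets stuck at a `d`-dimensional complex. -/
def GetsStuckAtDim {V : Type*} (X : PreAbstractSimplicialComplex V) (d : ℕ) : Prop :=
  ∃ Y : PreAbstractSimplicialComplex V, X.GetsStuckAt Y ∧ Y.HasDim d

/-- The geometric realization of a complex on a finite ground set, in barycentric coordinates:
the points of the standard simplex that are supported on a face of `X`. It carries the subspace
topology of `V → ℝ`. -/
def realization {V : Type*} [Fintype V] (X : PreAbstractSimplicialComplex V) : Set (V → ℝ) :=
  {x | x ∈ stdSimplex ℝ V ∧ ∃ s ∈ X, ∀ v : V, v ∉ s → x v = 0}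

/-- `X` is contractible: its geometric realization is homotopy equivalent to a point. -/
def IsContractible {V : Type*} [Fintype V] (X : PreAbstractSimplicialComplex V) : Prop :=
  ContractibleSpace X.realization

end PreAbstractSimplicialComplex

/-! Reduced homology over `ZMod 2` vanishes for a contractible complex (`IsContractible.acyclic`)
and stays zero under elementary collapses (`ElementaryCollapse.acyclic`). Hence a stuck `Y` carries
no nonzero cycle of its top dimension `d` (`Acyclic.eq_zero_of_card_eq`).

Let `W` be the vertex set of `Y`; then `d + 1 ≤ |W| ≤ n ≤ d + 3`. If `|W| = d + 1`, `Y` contains the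
full simplex on `W`, which has a free face unless `d = 0`. If `|W| = d + 2`, absence of free faces
forces every `(d + 1)`-subset of `W` into `Y`, and their sum is a cycle. If `|W| = d + 3`, join two
points of `W` when the complement of the pair is a face. Absence of free faces makes non-adjacency
transitive (`sdiff_pair_mem_or`), so this graph is complete multipartite. All pairs separated by one
class are then edges, and the complements of these pairs form a cycle, since a triple contains an
even number of pairs of a cut.

Acyclicity is proved with ordered simplices: a cycle is subdivided finely, carried by prisms along a
discretized contraction to show that it bounds, and brought back to faces of `X` by a Sperner
labelling. -/

/-- Chains with coefficients in `ZMod 2` on the ordered simplices (lists of points) of `P`,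
augmented by the empty list. -/
abbrev ListChain (P : Type*) := List P →₀ ZMod 2

/-! ### Ordered chains mod 2: cones, prisms, small simplices. -/

namespace ListChain

variable {P Q : Type*}

/-- Attach the vertex `x` in front of all lists of a chain. -/
noncomputable def cons (x : P) : ListChain P →ₗ[ZMod 2] ListChain P :=
  Finsupp.lmapDomain (ZMod 2) (ZMod 2) (List.cons x)

/-- The boundary of a single list: the sum of the lists with one entry deleted. -/
noncomputable def bdryList : List P → ListChain P
  | [] => 0
  | x :: l => Finsupp.single l 1 + cons x (bdryList l)

/-- The boundary operator of the augmented complex of ordered chains. -/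
noncomputable def bdry : ListChain P →ₗ[ZMod 2] ListChain P :=
  Finsupp.linearCombination (ZMod 2) bdryList

/-- The chain map induced by a map of points. -/
noncomputable def push (f : P → Q) : ListChain P →ₗ[ZMod 2] ListChain Q :=
  Finsupp.lmapDomain (ZMod 2) (ZMod 2) (List.map f)

/-- The prism between the images of a list under two maps of points. -/
noncomputable def prismList (f g : P → Q) : List P → ListChain Q
  | [] => 0
  | x :: l => Finsupp.single (f x :: g x :: l.map g) 1 + cons (f x) (prismList f g l)

/-- The chain homotopy between the chain maps induced by two maps of points. -/
noncomputable def prism (f g : P → Q) : ListChain P →ₗ[ZMod 2] ListChain Q :=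
  Finsupp.linearCombination (ZMod 2) (prismList f g)

@[simp] lemma cons_single (x : P) (l : List P) (a : ZMod 2) :
    cons x (Finsupp.single l a) = Finsupp.single (x :: l) a := by
  simp [cons]

@[simp] lemma push_single (f : P → Q) (l : List P) (a : ZMod 2) :
    push f (Finsupp.single l a) = Finsupp.single (l.map f) a := by
  simp [push]

@[simp] lemma bdry_single (l : List P) : bdry (Finsupp.single l 1) = bdryList l := by
  simp [bdry]

@[simp] lemma prism_single (f g : P → Q) (l : List P) :
    prism f g (Finsupp.single l 1) = prismList f g l := by
  simp [prism]

/-- Two linear maps that agree on single lists agree. -/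
lemma hom_ext {M : Type*} [AddCommGroup M] [Module (ZMod 2) M] {F G : ListChain P →ₗ[ZMod 2] M}
    (h : ∀ l, F (Finsupp.single l 1) = G (Finsupp.single l 1)) : F = G := by
  ext l
  simpa using h l

/-- The cone formula: a cycle `c` is the boundary of `cons x c`. -/
lemma bdry_cons (x : P) (c : ListChain P) : bdry (cons x c) = c + cons x (bdry c) := by
  have : bdry ∘ₗ cons x = LinearMap.id + cons x ∘ₗ bdry :=
    hom_ext fun l => by simp [bdryList]
  simpa using LinearMap.congr_fun this c

lemma push_cons (f : P → Q) (x : P) (c : ListChain P) :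
    push f (cons x c) = cons (f x) (push f c) := by
  have : push f ∘ₗ cons x = cons (f x) ∘ₗ push f := hom_ext fun l => by simp
  simpa using LinearMap.congr_fun this c

lemma prism_cons (f g : P → Q) (x : P) (c : ListChain P) :
    prism f g (cons x c) = cons (f x) (cons (g x) (push g c)) + cons (f x) (prism f g c) := by
  have : prism f g ∘ₗ cons x =
      cons (f x) ∘ₗ cons (g x) ∘ₗ push g + cons (f x) ∘ₗ prism f g :=
    hom_ext fun l => by simp [prismList]
  simpa using LinearMap.congr_fun this c

lemma bdry_push (f : P → Q) (c : ListChain P) : bdry (push f c) = push f (bdry c) := by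
  have : bdry ∘ₗ push f = push f ∘ₗ bdry := hom_ext fun l => by
    induction l with
    | nil => simp [bdryList]
    | cons x l ih =>
      simp only [LinearMap.comp_apply, push_single, bdry_single] at ih ⊢
      simp [bdryList, push_cons, ih]
  simpa using LinearMap.congr_fun this c

/-- The usual prism homotopy, without signs mod 2. On the empty list both sides vanish because the
two images coincide. -/
lemma bdry_prism (f g : P → Q) (c : ListChain P) :
    bdry (prism f g c) + prism f g (bdry c) = push f c + push g c := by
  have : bdry ∘ₗ prism f g + prism f g ∘ₗ bdry = push f + push g := hom_ext fun l => by
    induction l with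
    | nil => simp [bdryList, prismList, ZModModule.add_self]
    | cons x l ih =>
      simp only [LinearMap.add_apply, LinearMap.comp_apply, push_single, bdry_single,
        prism_single] at ih ⊢
      have ih' := congrArg (cons (f x)) ih
      simp only [map_add, cons_single] at ih'
      have h2 : ∀ c : ListChain Q, c + c = 0 := fun c => ZModModule.add_self c
      have e := bdry_push g (Finsupp.single l 1)
      simp only [push_single, bdry_single] at e
      simp only [bdryList, prismList, map_add, bdry_cons, prism_cons, bdry_single, prism_single,
        cons_single, e, List.map_cons]
      linear_combination (norm := module) ih' +
        h2 (cons (f x) (cons (g x) (push g (bdryList l)))) + h2 (prismList f g l) +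
        h2 (Finsupp.single (f x :: l.map g) 1)
  simpa using LinearMap.congr_fun this c

/-- The lists with length in `K` any two entries of which are related by `R`. -/
def Small (R : P → P → Prop) (K : Set ℕ) : Set (List P) :=
  {l | l.length ∈ K ∧ ∀ x ∈ l, ∀ y ∈ l, R x y}

/-- A linear map carries chains supported on `S` into `M` if it does so for single lists. -/
lemma map_mem_of_supported {M : Type*} [AddCommGroup M] [Module (ZMod 2) M] {S : Set (List P)}
    {T : Submodule (ZMod 2) M} (F : ListChain P →ₗ[ZMod 2] M)
    (h : ∀ l ∈ S, F (Finsupp.single l 1) ∈ T) {c : ListChain P}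
    (hc : c ∈ Finsupp.supported (ZMod 2) (ZMod 2) S) : F c ∈ T := by
  have : Finsupp.supported (ZMod 2) (ZMod 2) S ≤ T.comap F := by
    rw [Finsupp.supported_eq_span_single, Submodule.span_le]
    rintro _ ⟨l, hl, rfl⟩
    exact h l hl
  exact this hc

/-- Bounds the support of a prism, so that its smallness follows from comparing values of `f` and
`g` at pairs of entries. -/
lemma prismList_mem (f g : P → Q) (l : List P) :
    prismList f g l ∈ Finsupp.supported (ZMod 2) (ZMod 2)
      {l' | l'.length = l.length + 1 ∧ ∀ z ∈ l', ∃ x ∈ l, z = f x ∨ z = g x} := by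
  induction l with
  | nil => simp [prismList]
  | cons x l ih =>
    refine add_mem (Finsupp.single_mem_supported _ _ ?_) (map_mem_of_supported _ ?_ ih)
    · simp only [Set.mem_ofPred_eq, List.length_cons, List.length_map, List.mem_cons, List.mem_map,
        true_and]
      grind
    · rintro l' ⟨h1, h2⟩
      rw [cons_single]
      refine Finsupp.single_mem_supported _ _ ?_
      simp only [Set.mem_ofPred_eq, List.length_cons, List.mem_cons]
      grind

/-- If a sequence of maps with small steps ends at a constant map, then it carries every cycle
of small simplices to a boundary of small simplices. -/
theorem exists_bdry_eq_push {R' : P → P → Prop} {R : Q → Q → Prop} (N : ℕ) (f : ℕ → P → Q) (q : Q)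
    (hN : ∀ x, R' x x → f N x = q) (hq : R q q)
    (h : ∀ i < N, ∀ x y, R' x y → R (f i x) (f i y) ∧ R (f i x) (f (i + 1) y) ∧
      R (f (i + 1) x) (f i y) ∧ R (f (i + 1) x) (f (i + 1) y))
    {K K' : Set ℕ} (hK : ∀ k ∈ K, k + 1 ∈ K') {c : ListChain P}
    (hc : c ∈ Finsupp.supported (ZMod 2) (ZMod 2) (Small R' K)) (hd : bdry c = 0) :
    ∃ b ∈ Finsupp.supported (ZMod 2) (ZMod 2) (Small R K'), bdry b = push (f 0) c := by
  induction N generalizing f with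
  | zero =>
    -- Here `f 0` is already constant on the entries that occur, so the cone with apex `q` involves
    -- only the point `q`.
    refine ⟨cons q (push (f 0) c), ?_, by simp [bdry_cons, bdry_push, hd]⟩
    refine map_mem_of_supported (cons q ∘ₗ push (f 0)) ?_ hc
    rintro l ⟨h1, h2⟩
    simp only [LinearMap.comp_apply, push_single, cons_single]
    refine Finsupp.single_mem_supported _ _ ?_
    have : ∀ z ∈ q :: l.map (f 0), z = q := by
      simp only [List.mem_cons, List.mem_map]
      rintro z (rfl | ⟨x, hx, rfl⟩)
      · rfl
      · exact hN x (h2 x hx x hx)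
    refine ⟨by simpa using hK _ h1, fun x hx y hy => ?_⟩
    rw [this x hx, this y hy]
    exact hq
  | succ N ih =>
    obtain ⟨b, hb, hbd⟩ := ih (fun i => f (i + 1)) hN
      (fun i hi => h (i + 1) (by omega))
    -- The prism links `f 0` to `f 1`, from where the shifted sequence takes over.
    refine ⟨b + prism (f 0) (f 1) c, add_mem hb (map_mem_of_supported _ ?_ hc), ?_⟩
    · rintro l ⟨h1, h2⟩
      rw [prism_single]
      refine Finsupp.supported_mono ?_ (prismList_mem (f 0) (f 1) l)
      rintro l' ⟨h3, h4⟩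
      refine ⟨h3 ▸ hK _ h1, fun z hz w hw => ?_⟩
      obtain ⟨x, hx, hzx⟩ := h4 z hz
      obtain ⟨y, hy, hwy⟩ := h4 w hw
      have := h 0 (by omega) x y (h2 x hx y hy)
      rcases hzx with rfl | rfl <;> rcases hwy with rfl | rfl
      exacts [this.1, this.2.1, this.2.2.1, this.2.2.2]
    · have := bdry_prism (f 0) (f 1) c
      rw [hd, map_zero, add_zero] at this
      rw [map_add, this, hbd, add_left_comm, ZModModule.add_self, add_zero]

end ListChain

/-! ### Unordered chains of faces. -/

namespace FaceChain

open ListChain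

variable {V : Type*} [Fintype V] [DecidableEq V]

/-- The boundary operator on chains of (unordered) faces with coefficients in `ZMod 2`, augmented
by the empty face. -/
def bdry : (Finset V → ZMod 2) →ₗ[ZMod 2] (Finset V → ZMod 2) where
  toFun c σ := ∑ v ∈ σᶜ, c (insert v σ)
  map_add' c c' := by ext σ; simp [Finset.sum_add_distrib]
  map_smul' a c := by ext σ; simp [Finset.mul_sum]

lemma bdry_apply (c : Finset V → ZMod 2) (σ : Finset V) :
    bdry c σ = ∑ v ∈ σᶜ, c (insert v σ) := rfl

/-- Forget the order of simplices; lists with a repeated entry are sent to zero. -/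
noncomputable def ofList : ListChain V →ₗ[ZMod 2] (Finset V → ZMod 2) :=
  Finsupp.linearCombination (ZMod 2) fun l σ => if l.Nodup ∧ l.toFinset = σ then 1 else 0

omit [Fintype V] in
lemma ofList_single (l : List V) (σ : Finset V) :
    ofList (Finsupp.single l 1) σ = if l.Nodup ∧ l.toFinset = σ then 1 else 0 := by
  simp [ofList]

omit [Fintype V] in
lemma ofList_cons (x : V) (c : ListChain V) (σ : Finset V) :
    ofList (cons x c) σ = if x ∈ σ then ofList c (σ.erase x) else 0 := by
  have : LinearMap.proj σ ∘ₗ ofList ∘ₗ cons x =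
      if x ∈ σ then LinearMap.proj (σ.erase x) ∘ₗ ofList else 0 := hom_ext fun l => by
    by_cases h : x ∈ σ
    · simp only [h, if_true, LinearMap.comp_apply, LinearMap.proj_apply, cons_single,
        ofList_single, List.nodup_cons, List.toFinset_cons]
      congr 1
      rw [← List.mem_toFinset, eq_iff_iff]
      constructor
      · rintro ⟨⟨h1, h2⟩, rfl⟩
        exact ⟨h2, by simp [Finset.erase_insert h1]⟩
      · rintro ⟨h1, h2⟩
        exact ⟨⟨by simp [h2], h1⟩, by rw [h2, Finset.insert_erase h]⟩
    · simp only [h, if_false, LinearMap.comp_apply, LinearMap.proj_apply, cons_single,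
        ofList_single, List.toFinset_cons, LinearMap.zero_apply]
      rw [if_neg]
      rintro ⟨-, rfl⟩
      simp at h
  have := LinearMap.congr_fun this c
  split_ifs with h <;> simpa [h] using this

/-- If the head `x` recurs in the tail, deleting either copy gives the same set, and the two terms
cancel mod 2. -/
theorem bdry_ofList (c : ListChain V) : bdry (ofList c) = ofList (ListChain.bdry c) := by
  have : bdry ∘ₗ ofList = ofList ∘ₗ ListChain.bdry (P := V) := hom_ext fun l => by
    induction l with
    | nil =>
      ext σ
      simp [bdryList, bdry_apply, ofList_single, Finset.insert_ne_empty, eq_comm (a := ∅)]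
    | cons x l ih =>
      ext σ
      have ih' := congrFun ih (σ.erase x)
      simp only [LinearMap.comp_apply, bdry_single, bdryList, map_add, Pi.add_apply,
        ofList_cons, bdry_apply] at ih' ⊢
      rw [← cons_single]
      simp only [ofList_cons]
      by_cases h : x ∈ σ
      · simp only [h, if_true, ← ih', Finset.mem_insert, or_true]
        rw [Finset.compl_erase, Finset.sum_insert (by simpa using h), Finset.insert_erase h,
          ← add_assoc, CharTwo.add_self_eq_zero, zero_add]
        refine Finset.sum_congr rfl fun v hv => ?_
        rw [Finset.erase_insert_of_ne]
        rintro rfl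
        simp [h] at hv
      · simp only [h, if_false, Finset.mem_insert, or_false, add_zero]
        rw [Finset.sum_eq_single_of_mem x (by simpa using h)]
        · simp [Finset.erase_insert h]
        · intro v _ hv
          simp [hv.symm]
  exact LinearMap.congr_fun this c

end FaceChain

/-! ### Fine subdivisions of the standard simplex. -/

/-- The closed face of the standard simplex spanned by a set of vertices. -/
def stdFace {V : Type*} [Fintype V] (σ : Finset V) : Set (V → ℝ) :=
  {x | x ∈ stdSimplex ℝ V ∧ ∀ v, v ∉ σ → x v = 0}

/-- Two points of `K` at distance less than `ε`. -/
def CloseIn {E : Type*} [PseudoMetricSpace E] (K : Set E) (ε : ℝ) (x y : E) : Prop :=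
  x ∈ K ∧ y ∈ K ∧ dist x y < ε

namespace ListChain

lemma Small.mono {P : Type*} {R R' : P → P → Prop} (h : ∀ x y, R x y → R' x y) (K : Set ℕ) :
    Small R K ⊆ Small R' K :=
  fun _ hl => ⟨hl.1, fun x hx y hy => h x y (hl.2 x hx y hy)⟩

lemma push_eq_self {P : Type*} {f : P → P} (hf : ∀ x, f x = x) (c : ListChain P) :
    push f c = c := by
  obtain rfl : f = id := funext hf
  simp [push]

/-- In a bounded convex set, small cycles bound slightly larger chains. -/
theorem exists_bdry_eq_of_convex {E : Type*} [NormedAddCommGroup E] [NormedSpace ℝ E]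
    {K : Set E} (hK : Convex ℝ K) {q : E} (hq : q ∈ K) {D : ℝ} (hD : ∀ x ∈ K, dist x q ≤ D)
    {δ ε : ℝ} (hδε : δ < ε) (hε : 0 < ε) {k : ℕ} {c : ListChain E}
    (hc : c ∈ Finsupp.supported (ZMod 2) (ZMod 2) (Small (CloseIn K δ) {k})) (hd : bdry c = 0) :
    ∃ b ∈ Finsupp.supported (ZMod 2) (ZMod 2) (Small (CloseIn K ε) {k + 1}), bdry b = c := by
  obtain ⟨N, hN⟩ := exists_nat_gt (D / (ε - δ))
  have hD0 : 0 ≤ D := dist_nonneg.trans (hD q hq)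
  have hN0 : (0 : ℝ) < N := (div_nonneg hD0 (sub_pos.2 hδε).le).trans_lt hN
  rw [div_lt_iff₀ (sub_pos.2 hδε)] at hN
  -- Straight-line contraction to `q` in `N` steps: each step moves a point by at most `D / N < ε -
  -- δ` and no stage increases distances.
  let f : ℕ → E → E := fun i x => AffineMap.lineMap x q ((i : ℝ) / N)
  have key : ∀ i ≤ N, ∀ j ≤ N, |(i : ℝ) - j| ≤ 1 → ∀ x y, CloseIn K δ x y →
      CloseIn K ε (f i x) (f j y) := by
    intro i hi j hj hij x y ⟨hx, hy, hxy⟩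
    have hmem : ∀ i ≤ N, ((i : ℝ) / N) ∈ Set.Icc (0 : ℝ) 1 := fun i hi =>
      ⟨by positivity, (div_le_one hN0).2 (by exact_mod_cast hi)⟩
    refine ⟨hK.lineMap_mem hx hq (hmem i hi), hK.lineMap_mem hy hq (hmem j hj), ?_⟩
    have h1 : dist (f i x) (f i y) ≤ dist x y := by
      have : f i x - f i y = (1 - (i : ℝ) / N) • (x - y) := by
        simp only [f, AffineMap.lineMap_apply_module]
        module
      rw [dist_eq_norm, this, norm_smul, dist_eq_norm, Real.norm_of_nonneg]
      · exact mul_le_of_le_one_left (norm_nonneg _) (by linarith [(hmem i hi).1])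
      · linarith [(hmem i hi).2]
    have h2 : dist (f i y) (f j y) ≤ D / N := by
      simp only [f]
      rw [dist_lineMap_lineMap, Real.dist_eq, ← sub_div, abs_div, abs_of_pos hN0, div_mul_eq_mul_div]
      gcongr
      exact (mul_le_of_le_one_left dist_nonneg hij).trans (hD y hy)
    have h3 : D / N < ε - δ := by rw [div_lt_iff₀ hN0]; linarith
    linarith [dist_triangle (f i x) (f i y) (f j y)]
  obtain ⟨b, hb, hbd⟩ := exists_bdry_eq_push (R := CloseIn K ε) (K' := {k + 1}) N f q
    (fun x _ => by simp [f, hN0.ne']) ⟨hq, hq, by simpa using hε⟩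
    (fun i hi x y hxy => ⟨key i hi.le i hi.le (by simp) x y hxy,
      key i hi.le (i + 1) hi (by simp) x y hxy, key (i + 1) hi i hi.le (by simp) x y hxy,
      key (i + 1) hi (i + 1) hi (by simp) x y hxy⟩) (by simp) hc hd
  exact ⟨b, hb, by rw [hbd, push_eq_self fun x => by simp [f]]⟩

end ListChain

section Carrier

open ListChain

variable {V : Type*} [Fintype V] [DecidableEq V]

omit [Fintype V] in
lemma sum_erase_erase_eq_zero {M : Type*} [AddCommGroup M] [Module (ZMod 2) M]
    (s : Finset V → M) (σ : Finset V) :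
    ∑ v ∈ σ, ∑ u ∈ σ.erase v, s ((σ.erase v).erase u) = 0 := by
  rw [Finset.sum_sigma']
  refine Finset.sum_involution (fun p _ => ⟨p.2, p.1⟩) ?_ ?_ ?_ ?_
  · rintro ⟨v, u⟩ _
    dsimp only
    rw [Finset.erase_right_comm, ZModModule.add_self]
  · rintro ⟨v, u⟩ h _ h'
    simp only [Finset.mem_sigma, Finset.mem_erase] at h
    exact h.2.1 (congrArg Sigma.fst h')
  · rintro ⟨v, u⟩ h
    simp only [Finset.mem_sigma, Finset.mem_erase] at h ⊢
    exact ⟨h.2.2, h.2.1.symm, h.1⟩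
  · rintro ⟨v, u⟩ _
    rfl

omit [DecidableEq V] in
lemma convex_stdFace (σ : Finset V) : Convex ℝ (stdFace σ) := by
  intro x hx y hy a b ha hb hab
  refine ⟨convex_stdSimplex ℝ V hx.1 hy.1 ha hb hab, fun v hv => ?_⟩
  simp [hx.2 v hv, hy.2 v hv]

omit [DecidableEq V] in
lemma stdFace_mono {σ τ : Finset V} (h : σ ⊆ τ) : stdFace σ ⊆ stdFace τ :=
  fun _ hx => ⟨hx.1, fun v hv => hx.2 v fun h' => hv (h h')⟩

omit [DecidableEq V] in
lemma dist_le_one_of_mem_stdFace {σ : Finset V} {x y : V → ℝ} (hx : x ∈ stdFace σ)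
    (hy : y ∈ stdFace σ) : dist x y ≤ 1 := by
  refine (dist_pi_le_iff zero_le_one).2 fun v => ?_
  have h1 := mem_Icc_of_mem_stdSimplex hx.1 v
  have h2 := mem_Icc_of_mem_stdSimplex hy.1 v
  exact (Real.dist_le_of_mem_Icc h1 h2).trans (by simp)

/-- Induction over skeleta: the subdivided boundary of a face is a cycle in a convex set, hence
bounds there. Each filling costs an additional `η` in mesh size. -/
lemma exists_carrier_aux {η : ℝ} (hη : 0 < η) (n : ℕ) :
    ∃ s : Finset V → ListChain (V → ℝ), s ∅ = Finsupp.single [] 1 ∧ ∀ σ : Finset V, σ.card ≤ n →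
      s σ ∈ Finsupp.supported (ZMod 2) (ZMod 2)
        (Small (CloseIn (stdFace σ) (η * (σ.card + 1))) {σ.card}) ∧
      bdry (s σ) = ∑ v ∈ σ, s (σ.erase v) := by
  induction n with
  | zero =>
    refine ⟨fun _ => Finsupp.single [] 1, rfl, fun σ hσ => ?_⟩
    obtain rfl := Finset.card_eq_zero.1 (Nat.le_zero.1 hσ)
    exact ⟨Finsupp.single_mem_supported _ _ (by simp [ListChain.Small]), by simp [bdryList]⟩
  | succ n ih =>
    obtain ⟨s, hs0, hs⟩ := ih
    have hex : ∀ σ : Finset V, ∃ b, σ.card = n + 1 → b ∈ Finsupp.supported (ZMod 2) (ZMod 2)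
        (Small (CloseIn (stdFace σ) (η * (σ.card + 1))) {σ.card}) ∧
        bdry b = ∑ v ∈ σ, s (σ.erase v) := by
      intro σ
      by_cases hσ : σ.card = n + 1
      swap
      · exact ⟨0, fun h => (hσ h).elim⟩
      obtain ⟨w, hw⟩ : σ.Nonempty := Finset.card_pos.1 (by omega)
      have hq : Pi.single w 1 ∈ stdFace σ :=
        ⟨single_mem_stdSimplex ℝ w, fun v hv => Pi.single_eq_of_ne (by rintro rfl; exact hv hw) _⟩
      have hcard : ∀ v ∈ σ, (σ.erase v).card = n := fun v hv => by
        rw [Finset.card_erase_of_mem hv, hσ]; rfl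
      have hmem : ∑ v ∈ σ, s (σ.erase v) ∈ Finsupp.supported (ZMod 2) (ZMod 2)
          (Small (CloseIn (stdFace σ) (η * (n + 1))) {n}) := by
        refine sum_mem fun v hv => ?_
        have h := (hs _ (hcard v hv).le).1
        rw [hcard v hv] at h
        exact Finsupp.supported_mono (Small.mono (fun x y hxy =>
          ⟨stdFace_mono (σ.erase_subset v) hxy.1, stdFace_mono (σ.erase_subset v) hxy.2.1,
            hxy.2.2⟩) {n}) h
      have hcyc : bdry (∑ v ∈ σ, s (σ.erase v)) = 0 := by
        rw [map_sum, ← sum_erase_erase_eq_zero s σ]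
        exact Finset.sum_congr rfl fun v hv => (hs _ (hcard v hv).le).2
      obtain ⟨b, hb, hbd⟩ := exists_bdry_eq_of_convex (convex_stdFace σ) hq
        (fun x hx => dist_le_one_of_mem_stdFace hx hq) (ε := η * (σ.card + 1))
        (by rw [hσ]; push_cast; linarith) (by positivity) hmem hcyc
      exact ⟨b, fun _ => ⟨by rw [hσ] at hb ⊢; exact hb, hbd⟩⟩
    choose g hg using hex
    have hlt : ∀ σ : Finset V, σ.card ≤ n + 1 → ∀ v ∈ σ, (σ.erase v).card ≤ n := fun σ h v hv => by
      rw [Finset.card_erase_of_mem hv]; omega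
    refine ⟨fun σ => if σ.card ≤ n then s σ else g σ, by simp [hs0], fun σ hσ => ?_⟩
    have hsum : ∑ v ∈ σ, (if (σ.erase v).card ≤ n then s (σ.erase v) else g (σ.erase v)) =
        ∑ v ∈ σ, s (σ.erase v) :=
      Finset.sum_congr rfl fun v hv => if_pos (hlt σ hσ v hv)
    rw [hsum]
    by_cases h : σ.card ≤ n
    · simpa only [h, if_true] using hs σ h
    · simpa only [h, if_false] using hg σ (by omega)

/-- There are arbitrarily fine subdivisions of the faces of the standard simplex, compatible with
the boundary operators. -/
theorem exists_carrier {δ : ℝ} (hδ : 0 < δ) :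
    ∃ s : Finset V → ListChain (V → ℝ), s ∅ = Finsupp.single [] 1 ∧ ∀ σ : Finset V,
      s σ ∈ Finsupp.supported (ZMod 2) (ZMod 2) (Small (CloseIn (stdFace σ) δ) {σ.card}) ∧
      bdry (s σ) = ∑ v ∈ σ, s (σ.erase v) := by
  have hn : (0 : ℝ) < Fintype.card V + 1 := by positivity
  obtain ⟨s, hs0, hs⟩ := exists_carrier_aux (V := V) (div_pos hδ hn) (Fintype.card V)
  refine ⟨s, hs0, fun σ => ?_⟩
  have h := hs σ (Finset.card_le_univ σ)
  refine ⟨Finsupp.supported_mono (Small.mono (fun x y hxy => ⟨hxy.1, hxy.2.1, ?_⟩) _) h.1, h.2⟩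
  refine hxy.2.2.trans_le ?_
  rw [div_mul_eq_mul_div, div_le_iff₀ hn]
  gcongr
  exact_mod_cast Finset.card_le_univ σ

end Carrier

open ListChain

/-! ### Sperner labellings. -/

section Sperner

variable {V : Type*} [Fintype V] [DecidableEq V]

omit [Fintype V] in
lemma FaceChain.ofList_push_eq_zero {P : Type*} {p : P → V} {S : Set (List P)} {c : ListChain P}
    {σ : Finset V} (hc : c ∈ Finsupp.supported (ZMod 2) (ZMod 2) S)
    (h : ∀ l ∈ S, (l.map p).Nodup → (l.map p).toFinset ≠ σ) :
    FaceChain.ofList (push p c) σ = 0 := by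
  have := map_mem_of_supported (T := ⊥) (LinearMap.proj σ ∘ₗ FaceChain.ofList ∘ₗ push p)
    (fun l hl => ?_) hc
  · simpa using this
  · simp only [LinearMap.comp_apply, push_single, LinearMap.proj_apply, Submodule.mem_bot]
    rw [FaceChain.ofList_single, if_neg]
    exact fun h' => h l hl h'.1 h'.2

/-- Sperner's lemma: a labelling of the points by vertices of their supports carries
the subdivision of a face to the face itself. -/
theorem ofList_push_carrier {R : Finset V → (V → ℝ) → (V → ℝ) → Prop} {p : (V → ℝ) → V}
    (hp : ∀ σ x, R σ x x → p x ∈ σ) {s : Finset V → ListChain (V → ℝ)}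
    (hs0 : s ∅ = Finsupp.single [] 1)
    (hs : ∀ σ : Finset V, s σ ∈ Finsupp.supported (ZMod 2) (ZMod 2) (Small (R σ) {σ.card}) ∧
      bdry (s σ) = ∑ v ∈ σ, s (σ.erase v)) (σ : Finset V) :
    FaceChain.ofList (push p (s σ)) = Pi.single σ 1 := by
  -- All labels lie in `σ` and the lists have `σ.card` entries, so a repetition-free list of labels
  -- exhausts `σ`.
  have hne : ∀ σ τ : Finset V, τ ≠ σ → FaceChain.ofList (push p (s σ)) τ = 0 := by
    intro σ τ hτ
    refine FaceChain.ofList_push_eq_zero (hs σ).1 ?_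
    rintro l ⟨hl1, hl2⟩ hnd rfl
    refine hτ (Finset.eq_of_subset_of_card_le ?_ ?_)
    · intro v hv
      obtain ⟨x, hx, rfl⟩ := List.mem_map.1 (List.mem_toFinset.1 hv)
      exact hp σ x (hl2 x hx x hx)
    · rw [List.toFinset_card_of_nodup hnd, List.length_map, Set.mem_singleton_iff.1 hl1]
  suffices h : ∀ n, ∀ σ : Finset V, σ.card = n → FaceChain.ofList (push p (s σ)) σ = 1 by
    ext τ
    by_cases hτ : τ = σ
    · subst hτ; simp [h _ τ rfl]
    · simp [hne σ τ hτ, hτ]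
  intro n
  induction n with
  | zero =>
    intro σ hσ
    obtain rfl := Finset.card_eq_zero.1 hσ
    simp [hs0, FaceChain.ofList_single]
  | succ n ih =>
    intro σ hσ
    obtain ⟨v, hv⟩ : σ.Nonempty := Finset.card_pos.1 (by omega)
    -- At a facet of `σ`, the boundary sees only the coefficient at `σ` on one side and only the
    -- subdivision of that facet on the other.
    have h1 := congrFun (FaceChain.bdry_ofList (push p (s σ))) (σ.erase v)
    rw [ListChain.bdry_push, (hs σ).2, FaceChain.bdry_apply, Finset.compl_erase,
      Finset.sum_insert (by simpa using hv), Finset.insert_erase hv, Finset.sum_eq_zero,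
      add_zero, map_sum, map_sum, Finset.sum_apply, Finset.sum_eq_single_of_mem v hv] at h1
    · rw [h1]
      exact ih _ (by rw [Finset.card_erase_of_mem hv, hσ]; rfl)
    · intro u hu huv
      refine hne _ _ fun h => ?_
      have : u ∈ σ.erase v := Finset.mem_erase.2 ⟨huv, hu⟩
      rw [h] at this
      simp at this
    · intro u hu
      refine hne _ _ fun h => ?_
      have : u ∈ insert u (σ.erase v) := Finset.mem_insert_self _ _
      rw [h] at this
      exact (Finset.mem_compl.1 hu) this

end Sperner

/-! ### Contractible complexes are acyclic. -/

namespace PreAbstractSimplicialComplex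

variable {V : Type*} [Fintype V] [DecidableEq V]

/-- A chain is supported on the faces of `X` and the empty face. -/
def Supports (X : PreAbstractSimplicialComplex V) (c : Finset V → ZMod 2) : Prop :=
  ∀ σ, c σ ≠ 0 → σ ∈ X ∨ σ = ∅

/-- The reduced homology of `X` with coefficients in `ZMod 2` vanishes. -/
def Acyclic (X : PreAbstractSimplicialComplex V) : Prop :=
  ∀ c, X.Supports c → FaceChain.bdry c = 0 → ∃ b, X.Supports b ∧ FaceChain.bdry b = c

omit [Fintype V] [DecidableEq V] in
lemma mem_of_subset {X : PreAbstractSimplicialComplex V} {σ τ : Finset V} (hσ : σ ∈ X)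
    (h : τ ⊆ σ) (hτ : τ.Nonempty) : τ ∈ X :=
  (X.isRelLowerSet_faces hσ).2 h hτ

omit [Fintype V] [DecidableEq V] in
lemma nonempty_of_mem {X : PreAbstractSimplicialComplex V} {σ : Finset V} (hσ : σ ∈ X) :
    σ.Nonempty :=
  (X.isRelLowerSet_faces hσ).1

omit [DecidableEq V] in
lemma realization_eq (X : PreAbstractSimplicialComplex V) :
    X.realization = ⋃ σ ∈ {σ | σ ∈ X}, stdFace σ := by
  ext x
  simp only [realization, stdFace, Set.mem_iUnion, Set.mem_ofPred_eq]
  grind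

omit [DecidableEq V] in
lemma isCompact_realization (X : PreAbstractSimplicialComplex V) : IsCompact X.realization := by
  rw [realization_eq]
  refine (Set.toFinite _).isCompact_biUnion fun σ _ => ?_
  have : stdFace σ = stdSimplex ℝ V ∩ ⋂ v ∈ {v | v ∉ σ}, {x | x v = 0} := by
    ext x; simp [stdFace]
  rw [this]
  refine (isCompact_stdSimplex ℝ V).inter_right ?_
  exact isClosed_biInter fun v _ => isClosed_eq (continuous_apply v) continuous_const

/-- A contractible space has a finite sequence of self-maps from the identity to a constant map,
consecutive ones of which are uniformly close. -/
lemma exists_discrete_contraction {E : Type*} [PseudoMetricSpace E] [CompactSpace E]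
    [ContractibleSpace E] {ε : ℝ} (hε : 0 < ε) :
    ∃ (N : ℕ) (f : ℕ → E → E) (q : E) (δ : ℝ), 0 < δ ∧ (∀ x, f 0 x = x) ∧ (∀ x, f N x = q) ∧
      ∀ i ≤ N, ∀ j ≤ N, |(i : ℝ) - j| ≤ 1 → ∀ x y, dist x y < δ → dist (f i x) (f j y) < ε := by
  obtain ⟨q, ⟨H⟩⟩ := id_nullhomotopic E
  obtain ⟨δ, hδ, hH⟩ := Metric.uniformContinuous_iff.1
    (CompactSpace.uniformContinuous_of_continuous H.continuous) ε hε
  -- Time steps of length `1 / N < δ` fall under the uniform continuity of the homotopy.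
  obtain ⟨N, hN⟩ := exists_nat_gt (1 / δ)
  have hN0 : (0 : ℝ) < N := (by positivity : (0 : ℝ) ≤ 1 / δ).trans_lt hN
  refine ⟨N, fun i x => H (Set.projIcc 0 1 zero_le_one ((i : ℝ) / N), x), q, δ, hδ, ?_, ?_, ?_⟩
  · intro x
    have : Set.projIcc (0 : ℝ) 1 zero_le_one (((0 : ℕ) : ℝ) / N) = 0 := by
      simp
    simp only [this]
    rw [H.apply_zero]; rfl
  · intro x
    have : Set.projIcc (0 : ℝ) 1 zero_le_one ((N : ℝ) / N) = 1 := by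
      rw [div_self hN0.ne']; simp
    simp only [this]
    rw [H.apply_one]; rfl
  · intro i hi j hj hij x y hxy
    refine hH (max_lt ?_ hxy)
    refine (?_ : _ ≤ dist ((i : ℝ) / N) ((j : ℝ) / N)).trans_lt ?_
    · exact Set.abs_projIcc_sub_projIcc zero_le_one
    · rw [Real.dist_eq, ← sub_div, abs_div, abs_of_pos hN0, div_lt_iff₀ hN0]
      rw [div_lt_iff₀ hδ] at hN
      linarith

-- A coordinate at least the average. Labelling by such a coordinate is stable: points closer than
-- `1 / |V|` are still positive there.
omit [DecidableEq V] in
lemma exists_large_coord [Nonempty V] {x : V → ℝ} (hx : x ∈ stdSimplex ℝ V) :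
    ∃ v, (Fintype.card V : ℝ)⁻¹ ≤ x v := by
  by_contra! h
  have := Finset.sum_lt_sum_of_nonempty Finset.univ_nonempty (fun v _ => h v)
  rw [hx.2] at this
  simp at this

/-- The reduced homology of a contractible complex vanishes. -/
theorem IsContractible.acyclic {X : PreAbstractSimplicialComplex V} (hX : X.IsContractible) :
    X.Acyclic := by
  intro c hc hcyc
  have : ContractibleSpace X.realization := hX
  have : CompactSpace X.realization := isCompact_iff_compactSpace.1 X.isCompact_realization
  have hne : Nonempty V := by
    obtain ⟨x, -, σ, hσ, -⟩ := (inferInstance : Nonempty X.realization)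
    exact ⟨(nonempty_of_mem hσ).choose⟩
  have hcard : (0 : ℝ) < (Fintype.card V : ℝ)⁻¹ := by
    have := Fintype.card_pos (α := V)
    positivity
  obtain ⟨N, f, q, δ, hδ, hf0, hfN, hf⟩ := exists_discrete_contraction (E := X.realization) hcard
  have hlab : ∀ x : V → ℝ, ∃ v, x ∈ stdSimplex ℝ V → (Fintype.card V : ℝ)⁻¹ ≤ x v := by
    intro x
    by_cases hx : x ∈ stdSimplex ℝ V
    · obtain ⟨v, hv⟩ := exists_large_coord hx
      exact ⟨v, fun _ => hv⟩
    · exact ⟨Classical.arbitrary V, fun h => (hx h).elim⟩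
  choose p hp using hlab
  obtain ⟨s, hs0, hs⟩ := exists_carrier (V := V) hδ
  let S : ListChain (V → ℝ) := ∑ σ, c σ • s σ
  have hpS : FaceChain.ofList (push p S) = c := by
    have h : ∀ σ, FaceChain.ofList (push p (s σ)) = Pi.single σ 1 := by
      refine ofList_push_carrier (fun σ x hx => ?_) hs0 hs
      by_contra h
      have := hp x hx.1.1
      rw [hx.1.2 _ h] at this
      linarith
    ext σ
    simp [S, map_sum, h, Finset.sum_apply, Pi.single_apply]
  have hS : bdry S = 0 := by
    -- Subdivision commutes with the boundary: pairs (face, vertex to delete) are reindexed as pairs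
    -- (face, vertex to insert).
    have h1 : bdry S = ∑ σ, FaceChain.bdry c σ • s σ := by
      simp only [S, map_sum, map_smul, (hs _).2, Finset.smul_sum, FaceChain.bdry_apply,
        Finset.sum_smul, Finset.sum_sigma']
      refine Finset.sum_bij' (fun a _ => ⟨a.1.erase a.2, a.2⟩) (fun a _ => ⟨insert a.2 a.1, a.2⟩)
        ?_ ?_ ?_ ?_ ?_
      · rintro ⟨σ, v⟩ h; simp
      · rintro ⟨σ, v⟩ h; simp
      · rintro ⟨σ, v⟩ h
        have : v ∈ σ := by simpa using h
        simp [Finset.insert_erase this]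
      · rintro ⟨σ, v⟩ h
        have : v ∉ σ := by simpa using h
        simp [Finset.erase_insert this]
      · rintro ⟨σ, v⟩ h
        have : v ∈ σ := by simpa using h
        simp [Finset.insert_erase this]
    rw [h1, hcyc]
    simp
  -- extend the contraction to the ambient space
  classical
  let F : ℕ → (V → ℝ) → (V → ℝ) := fun i x =>
    if h : x ∈ X.realization then (f i ⟨x, h⟩ : V → ℝ) else x
  have hF : ∀ i ≤ N, ∀ j ≤ N, |(i : ℝ) - j| ≤ 1 → ∀ x y, CloseIn X.realization δ x y →
      CloseIn X.realization (Fintype.card V : ℝ)⁻¹ (F i x) (F j y) := by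
    rintro i hi j hj hij x y ⟨hx, hy, hxy⟩
    simp only [F, hx, hy, dif_pos]
    exact ⟨Subtype.coe_prop _, Subtype.coe_prop _, hf i hi j hj hij ⟨x, hx⟩ ⟨y, hy⟩ hxy⟩
  have hSmem : S ∈ Finsupp.supported (ZMod 2) (ZMod 2)
      (Small (CloseIn X.realization δ) Set.univ) := by
    refine sum_mem fun σ _ => ?_
    by_cases hσ : c σ = 0
    · rw [hσ, zero_smul]; exact zero_mem _
    refine Submodule.smul_mem _ _ ?_
    rcases hc σ hσ with h | rfl
    · refine Finsupp.supported_mono ?_ (hs σ).1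
      rintro l ⟨-, hl⟩
      exact ⟨trivial, fun x hx y hy => ⟨⟨(hl x hx y hy).1.1, σ, h, (hl x hx y hy).1.2⟩,
        ⟨(hl x hx y hy).2.1.1, σ, h, (hl x hx y hy).2.1.2⟩, (hl x hx y hy).2.2⟩⟩
    · rw [hs0]
      exact Finsupp.single_mem_supported _ _ ⟨trivial, by simp⟩
  have hF1 : ∀ i : ℕ, |(i : ℝ) - (i + 1 : ℕ)| ≤ 1 ∧ |((i + 1 : ℕ) : ℝ) - i| ≤ 1 := fun i => by
    constructor <;> simp
  obtain ⟨b, hb, hbd⟩ := exists_bdry_eq_push (K' := Set.univ)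
    (R := CloseIn X.realization (Fintype.card V : ℝ)⁻¹) N F q
    (fun x hx => by simp [F, hx.1, hfN]) ⟨q.2, q.2, by simpa using hcard⟩
    (fun i hi x y hxy => ⟨hF i hi.le i hi.le (by simp) x y hxy,
      hF i hi.le (i + 1) hi (hF1 i).1 x y hxy, hF (i + 1) hi i hi.le (hF1 i).2 x y hxy,
      hF (i + 1) hi (i + 1) hi (by simp) x y hxy⟩) (fun _ _ => trivial) hSmem hS
  rw [push_eq_self fun x => by simp only [F, hf0]; split_ifs <;> rfl] at hbd
  refine ⟨FaceChain.ofList (push p b), ?_, by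
    rw [FaceChain.bdry_ofList, ListChain.bdry_push, hbd, hpS]⟩
  intro σ hσ
  by_contra! hσX
  refine hσ (FaceChain.ofList_push_eq_zero hb ?_)
  rintro l ⟨-, hl⟩ - rfl
  obtain ⟨x, hx⟩ : ∃ x, x ∈ l := by
    by_contra! h
    rw [List.eq_nil_iff_forall_not_mem.2 h] at hσX
    simp at hσX
  -- A face `τ` carrying one point `x` of the list contains all labels: `y (p y) ≥ 1 / |V|` and `y`
  -- is closer to `x` than that, so `x (p y) ≠ 0`.
  obtain ⟨hxs, τ, hτ, hxτ⟩ := (hl x hx x hx).1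
  refine hσX.1 (mem_of_subset hτ ?_ hσX.2)
  intro v hv
  obtain ⟨y, hy, rfl⟩ := List.mem_map.1 (List.mem_toFinset.1 hv)
  by_contra hvτ
  obtain ⟨-, hy', hxy⟩ := hl x hx y hy
  have h1 := hp y hy'.1
  have h2 := (dist_le_pi_dist x y (p y)).trans_lt hxy
  rw [hxτ _ hvτ, dist_zero_left, Real.norm_eq_abs] at h2
  exact absurd (h1.trans (le_abs_self _)) (not_le.2 h2)

end PreAbstractSimplicialComplex

/-! ### Cycles described by complements. -/

namespace FaceChain

variable {V : Type*} [Fintype V] [DecidableEq V]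

lemma bdry_bdry (c : Finset V → ZMod 2) : bdry (bdry c) = 0 := by
  ext σ
  simp only [bdry_apply, Finset.sum_sigma', Pi.zero_apply]
  refine Finset.sum_involution (fun p _ => ⟨p.2, p.1⟩) ?_ ?_ ?_ ?_
  · rintro ⟨v, u⟩ _
    dsimp only
    rw [Finset.insert_comm, CharTwo.add_self_eq_zero]
  · rintro ⟨v, u⟩ h _ h'
    simp only [Finset.mem_sigma, Finset.mem_compl, Finset.mem_insert, not_or] at h
    exact h.2.1 (congrArg Sigma.fst h')
  · rintro ⟨v, u⟩ h
    simp only [Finset.mem_sigma, Finset.mem_compl, Finset.mem_insert, not_or] at h ⊢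
    exact ⟨h.2.2, fun e => h.2.1 e.symm, h.1⟩
  · rintro ⟨v, u⟩ _
    rfl

/-- The chain of subsets of `W` with complement of size `k`, with coefficients given as
a function of the complement. -/
def ofCompl (W : Finset V) (k : ℕ) (F : Finset V → ZMod 2) (σ : Finset V) : ZMod 2 :=
  if σ ⊆ W ∧ (W \ σ).card = k then F (W \ σ) else 0

/-- Inserting a vertex into `ρ` deletes it from `W \ ρ`; vertices outside `W` contribute nothing. -/
lemma bdry_ofCompl (W : Finset V) (k : ℕ) (F : Finset V → ZMod 2)
    (hF : ∀ T : Finset V, T.card = k + 1 → ∑ v ∈ T, F (T.erase v) = 0) :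
    bdry (ofCompl W k F) = 0 := by
  ext ρ
  rw [bdry_apply, Pi.zero_apply]
  by_cases hρ : ρ ⊆ W ∧ (W \ ρ).card = k + 1
  · rw [← hF _ hρ.2]
    symm
    apply Finset.sum_subset_zero_on_sdiff
    · intro v; simp
    · intro v hv
      simp only [Finset.mem_sdiff, Finset.mem_compl] at hv
      refine if_neg fun h => hv.2 ⟨h.1 (Finset.mem_insert_self _ _), hv.1⟩
    · intro v hv
      have h : W \ insert v ρ = (W \ ρ).erase v := Finset.sdiff_insert _ _ _
      rw [ofCompl, if_pos, h]
      refine ⟨Finset.insert_subset (Finset.mem_sdiff.1 hv).1 hρ.1, ?_⟩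
      rw [h, Finset.card_erase_of_mem hv, hρ.2]; rfl
  · refine Finset.sum_eq_zero fun v hv => if_neg fun h => hρ ?_
    rw [Finset.mem_compl] at hv
    refine ⟨(Finset.subset_insert _ _).trans h.1, ?_⟩
    have hv' : v ∈ W \ ρ := Finset.mem_sdiff.2 ⟨h.1 (Finset.mem_insert_self _ _), hv⟩
    rw [Finset.sdiff_insert, Finset.card_erase_of_mem hv'] at h
    have := Finset.card_pos.2 ⟨v, hv'⟩
    omega

end FaceChain

/-! ### Collapses and acyclicity. -/

namespace PreAbstractSimplicialComplex

variable {V : Type*} [Fintype V] [DecidableEq V]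

/-- Elementary collapses preserve the vanishing of reduced homology. -/
theorem ElementaryCollapse.acyclic {X Y : PreAbstractSimplicialComplex V}
    (h : X.ElementaryCollapse Y) (hX : X.Acyclic) : Y.Acyclic := by
  obtain ⟨τ, σ, ⟨hτ, hfree⟩, hσ, hτσ, hY⟩ := h
  have huniq : ∀ ρ ∈ X, τ ⊂ ρ → ρ = σ := fun ρ h1 h2 => hfree.unique ⟨h1, h2⟩ ⟨hσ, hτσ⟩
  obtain ⟨w, hwσ, hwτ⟩ := Finset.exists_of_ssubset hτσ
  have hins : insert w τ = σ := huniq _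
    (mem_of_subset hσ (Finset.insert_subset hwσ hτσ.subset) (Finset.insert_nonempty _ _))
    (Finset.ssubset_insert hwτ)
  intro c hc hcyc
  obtain ⟨b, hb, rfl⟩ := hX c (fun ρ hρ => (hc ρ hρ).imp_left fun h => ((hY ρ).1 h).1) hcyc
  -- As `σ` is the only proper coface of `τ`, the boundary of `b` at `τ` is `b σ`; but the given
  -- cycle avoids `τ`.
  have hbσ : b σ = 0 := by
    have h1 : FaceChain.bdry b τ = 0 := by
      by_contra h
      rcases hc τ h with h | h
      · exact ((hY τ).1 h).2.1 rfl
      · exact (nonempty_of_mem hτ).ne_empty h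
    rw [FaceChain.bdry_apply, Finset.sum_eq_single_of_mem w (by simpa using hwτ), hins] at h1
    · exact h1
    · intro v hv hvw
      rw [Finset.mem_compl] at hv
      by_contra h
      rcases hb _ h with h | h
      · have h2 := huniq _ h (Finset.ssubset_insert hv)
        rw [← hins] at h2
        have h3 : v ∈ insert w τ := h2 ▸ Finset.mem_insert_self v τ
        simp [hvw, hv] at h3
      · exact Finset.insert_ne_empty _ _ h
  let e : Finset V → ZMod 2 := FaceChain.bdry (Pi.single σ 1)
  have heτ : e τ = 1 := by
    simp only [e, FaceChain.bdry_apply]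
    rw [Finset.sum_eq_single_of_mem w (by simpa using hwτ), hins, Pi.single_eq_same]
    intro v hv hvw
    refine Pi.single_eq_of_ne (fun h => hvw ?_) _
    rw [← hins] at h
    have h3 : v ∈ insert w τ := h ▸ Finset.mem_insert_self v τ
    simpa [Finset.mem_compl.1 hv] using h3
  have heσ : e σ = 0 := by
    simp only [e, FaceChain.bdry_apply]
    refine Finset.sum_eq_zero fun v hv => Pi.single_eq_of_ne (fun h => ?_) _
    exact Finset.mem_compl.1 hv (h ▸ Finset.mem_insert_self v σ)
  have heX : X.Supports e := by
    intro ρ hρ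
    obtain ⟨v, -, hv⟩ := Finset.exists_ne_zero_of_sum_ne_zero hρ
    have h : insert v ρ = σ := by
      by_contra h
      exact hv (Pi.single_eq_of_ne h _)
    rcases ρ.eq_empty_or_nonempty with h' | h'
    · exact Or.inr h'
    · exact Or.inl (mem_of_subset hσ (h ▸ Finset.subset_insert _ _) h')
  -- Adding a multiple of the boundary of `σ` cancels the coefficient at `τ` without changing the
  -- boundary.
  refine ⟨b + b τ • e, fun ρ hρ => ?_, by simp [e, FaceChain.bdry_bdry]⟩
  have h1 : ρ ≠ τ := by
    rintro rfl
    simp [heτ, CharTwo.add_self_eq_zero] at hρ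
  have h2 : ρ ≠ σ := by
    rintro rfl
    simp [heσ, hbσ] at hρ
  have h3 : ρ ∈ X ∨ ρ = ∅ := by
    by_cases h : b ρ = 0
    · refine heX ρ fun h' => hρ ?_
      simp [h, h']
    · exact hb ρ h
  exact h3.imp_left fun h => (hY ρ).2 ⟨h, h1, h2⟩

theorem CollapsesTo.acyclic {X Y : PreAbstractSimplicialComplex V}
    (h : X.CollapsesTo Y) (hX : X.Acyclic) : Y.Acyclic := by
  induction h with
  | refl => exact hX
  | tail _ h ih => exact h.acyclic ih

omit [Fintype V] [DecidableEq V] in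
lemma CollapsesTo.mem {X Y : PreAbstractSimplicialComplex V}
    (h : X.CollapsesTo Y) {σ : Finset V} (hσ : σ ∈ Y) : σ ∈ X := by
  induction h with
  | refl => exact hσ
  | tail _ h ih =>
    obtain ⟨_, _, -, -, -, hY⟩ := h
    exact ih ((hY σ).1 hσ).1

/-- An acyclic complex carries no cycle of top dimension. -/
lemma Acyclic.eq_zero_of_card_eq {Y : PreAbstractSimplicialComplex V} (hY : Y.Acyclic) {m : ℕ}
    (hm : ∀ s ∈ Y, s.card ≤ m) {z : Finset V → ZMod 2} (hz : Y.Supports z)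
    (hcyc : FaceChain.bdry z = 0) {σ : Finset V} (hσ : σ.card = m) : z σ = 0 := by
  obtain ⟨b, hb, rfl⟩ := hY z hz hcyc
  refine Finset.sum_eq_zero fun v hv => ?_
  by_contra h
  rcases hb _ h with h | h
  · have := hm _ h
    rw [Finset.card_insert_of_notMem (Finset.mem_compl.1 hv)] at this
    omega
  · exact Finset.insert_ne_empty _ _ h

omit [Fintype V] [DecidableEq V] in
lemma exists_ne_of_not_isFree {Y : PreAbstractSimplicialComplex V} {τ σ : Finset V}
    (h : ¬ Y.IsFree τ) (hτ : τ.Nonempty) (hσ : σ ∈ Y) (hτσ : τ ⊂ σ) :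
    ∃ ρ ∈ Y, τ ⊂ ρ ∧ ρ ≠ σ := by
  by_contra! h'
  exact h ⟨mem_of_subset hσ hτσ.subset hτ, σ, ⟨hσ, hτσ⟩, fun ρ hρ => h' ρ hρ.1 hρ.2⟩

omit [Fintype V] in
/-- A proper superset with at most one more element arises by inserting one element. -/
lemma exists_insert_of_ssubset {τ ρ : Finset V} (h : τ ⊂ ρ) (hc : ρ.card ≤ τ.card + 1) :
    ∃ t, t ∉ τ ∧ ρ = insert t τ := by
  obtain ⟨t, ht, htτ⟩ := Finset.exists_of_ssubset h
  refine ⟨t, htτ, (Finset.eq_of_subset_of_card_le (Finset.insert_subset ht h.subset) ?_).symm⟩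
  rw [Finset.card_insert_of_notMem htτ]
  exact hc

/-! ### Acyclic complexes without free faces, in codimension at most two. -/

section NoFreeFace

variable {Y : PreAbstractSimplicialComplex V} {d : ℕ} {W : Finset V}

omit [Fintype V] [DecidableEq V] in
lemma subset_of_mem (hW : ∀ v, v ∈ W ↔ {v} ∈ Y) {σ : Finset V} (hσ : σ ∈ Y) : σ ⊆ W :=
  fun v hv => (hW v).2 (mem_of_subset hσ (Finset.singleton_subset_iff.2 hv)
    (Finset.singleton_nonempty v))

omit [Fintype V] in
/-- A simplex without free faces is a single vertex. -/
lemma isSingleVertex_of_card_eq (hW : ∀ v, v ∈ W ↔ {v} ∈ Y) (hfree : ∀ τ, ¬ Y.IsFree τ)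
    (hd : Y.HasDim d) (hm : W.card = d + 1) : Y.IsSingleVertex := by
  obtain ⟨⟨s, hs, hsc⟩, -⟩ := hd
  obtain rfl : s = W := Finset.eq_of_subset_of_card_le (subset_of_mem hW hs) (by omega)
  obtain ⟨w, hw⟩ := nonempty_of_mem hs
  rcases Nat.eq_zero_or_pos d with rfl | hd0
  · obtain ⟨v, rfl⟩ := Finset.card_eq_one.1 hsc
    refine ⟨v, fun σ => ⟨fun hσ => ?_, fun h => h ▸ hs⟩⟩
    exact (Finset.subset_singleton_iff.1 (subset_of_mem hW hσ)).resolve_left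
      (nonempty_of_mem hσ).ne_empty
  · have hne : (s.erase w).Nonempty := Finset.card_pos.1 (by rw [Finset.card_erase_of_mem hw]; omega)
    obtain ⟨ρ, hρ, h1, h2⟩ := exists_ne_of_not_isFree (hfree _) hne hs (Finset.erase_ssubset hw)
    refine (h2 (Finset.eq_of_subset_of_card_le (subset_of_mem hW hρ) ?_)).elim
    have := Finset.card_lt_card h1
    rw [Finset.card_erase_of_mem hw] at this
    omega

/-- An acyclic complex without free faces is not of codimension one in the simplex on its
vertices. -/
lemma card_ne_add_two (hW : ∀ v, v ∈ W ↔ {v} ∈ Y) (hfree : ∀ τ, ¬ Y.IsFree τ)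
    (hd : Y.HasDim d) (hY : Y.Acyclic) : W.card ≠ d + 2 := by
  intro hm
  obtain ⟨⟨s, hs, hsc⟩, hle⟩ := hd
  have hsW := subset_of_mem hW hs
  have hs1 : (W \ s).card = 1 := by rw [Finset.card_sdiff_of_subset hsW]; omega
  have hsup : Y.Supports (FaceChain.ofCompl W 1 fun _ => 1) := by
    intro σ hσ
    left
    by_contra hσY
    obtain ⟨⟨hσW, hσ1⟩, -⟩ := ite_ne_right_iff.1 hσ
    rw [Finset.card_sdiff_of_subset hσW] at hσ1
    have hσc : σ.card = d + 1 := by omega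
    -- For `d = 0` the ridge `s ∩ σ` is empty and freeness says nothing. Otherwise `s` and `σ` are
    -- the only `(d + 1)`-subsets of `W` containing it, so a second coface must be `σ`.
    rcases Nat.eq_zero_or_pos d with rfl | hd0
    · obtain ⟨v, rfl⟩ := Finset.card_eq_one.1 hσc
      exact hσY ((hW v).1 (hσW (Finset.mem_singleton_self v)))
    · have hne : s ≠ σ := fun h => hσY (h ▸ hs)
      have hunion : (s ∪ σ).card ≤ d + 2 := hm ▸ Finset.card_le_card (Finset.union_subset hsW hσW)
      have hinter := Finset.card_union_add_card_inter s σ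
      have hss : s ∩ σ ⊂ s := by
        refine Finset.ssubset_iff_subset_ne.2 ⟨Finset.inter_subset_left, fun h => hne ?_⟩
        exact Finset.eq_of_subset_of_card_le (Finset.inter_eq_left.1 h) (by omega)
      have hlt := Finset.card_lt_card hss
      obtain ⟨ρ, hρ, h1, h2⟩ := exists_ne_of_not_isFree (hfree _)
        (Finset.card_pos.1 (by omega)) hs hss
      obtain ⟨t, ht, rfl⟩ := exists_insert_of_ssubset h1 (by have := hle ρ hρ; omega)
      have hins : ∀ α : Finset V, s ∩ σ ⊆ α → α.card = d + 1 → t ∈ α → insert t (s ∩ σ) = α := by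
        intro α h1 h2 h3
        refine Finset.eq_of_subset_of_card_le (Finset.insert_subset h3 h1) ?_
        rw [Finset.card_insert_of_notMem ht]; omega
      have hunion' : s ∪ σ = W :=
        Finset.eq_of_subset_of_card_le (Finset.union_subset hsW hσW) (by omega)
      have htW : t ∈ s ∪ σ := hunion' ▸ subset_of_mem hW hρ (Finset.mem_insert_self _ _)
      rcases Finset.mem_union.1 htW with h | h
      · exact h2 (hins s Finset.inter_subset_left hsc h)
      · exact hσY (hins σ Finset.inter_subset_right hσc h ▸ hρ)
  have h0 := hY.eq_zero_of_card_eq hle hsup (FaceChain.bdry_ofCompl _ _ _ fun T hT => by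
    rw [Finset.sum_const, hT]; rfl) hsc
  simp [FaceChain.ofCompl, hsW, hs1] at h0

omit [Fintype V] in
/-- In codimension two, missing pairs of vertices form a transitive relation unless there is
a free face. -/
lemma sdiff_pair_mem_or (hW : ∀ v, v ∈ W ↔ {v} ∈ Y) (hfree : ∀ τ, ¬ Y.IsFree τ)
    (hle : ∀ s ∈ Y, s.card ≤ d + 1) (hm : W.card = d + 3) {x y z : V} (hx : x ∈ W) (hy : y ∈ W)
    (hz : z ∈ W) (hxy : x ≠ y) (hyz : y ≠ z) (hxz : x ≠ z) (h : W \ {x, z} ∈ Y) :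
    W \ {x, y} ∈ Y ∨ W \ {y, z} ∈ Y := by
  have hsub : ({x, y, z} : Finset V) ⊆ W := by
    simp [Finset.insert_subset_iff, hx, hy, hz]
  have hc : (W \ {x, y, z}).card = d := by
    rw [Finset.card_sdiff_of_subset hsub, Finset.card_eq_three.2 ⟨x, y, z, hxy, hxz, hyz, rfl⟩]
    omega
  have hxz' : W \ {x, z} = insert y (W \ {x, y, z}) := by grind
  have hyz' : W \ {y, z} = insert x (W \ {x, y, z}) := by grind
  have hxy' : W \ {x, y} = insert z (W \ {x, y, z}) := by grind
  rw [hxz'] at h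
  rw [hyz', hxy']
  rcases Nat.eq_zero_or_pos d with rfl | hd0
  · rw [Finset.card_eq_zero.1 hc]
    exact Or.inl ((hW z).1 hz)
  · obtain ⟨ρ, hρ, h1, h2⟩ := exists_ne_of_not_isFree (hfree _)
      (Finset.card_pos.1 (by omega)) h (Finset.ssubset_insert (by simp))
    obtain ⟨t, ht, rfl⟩ := exists_insert_of_ssubset h1 (by have := hle ρ hρ; omega)
    have htW := subset_of_mem hW hρ (Finset.mem_insert_self _ _)
    simp only [Finset.mem_sdiff, htW, Finset.mem_insert, Finset.mem_singleton, true_and,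
      not_not] at ht
    rcases ht with rfl | rfl | rfl
    · exact Or.inr hρ
    · exact (h2 rfl).elim
    · exact Or.inl hρ

/-- An acyclic complex without free faces is not of codimension two in the simplex on its
vertices. -/
lemma card_ne_add_three (hW : ∀ v, v ∈ W ↔ {v} ∈ Y) (hfree : ∀ τ, ¬ Y.IsFree τ)
    (hd : Y.HasDim d) (hY : Y.Acyclic) : W.card ≠ d + 3 := by
  classical
  intro hm
  obtain ⟨⟨s, hs, hsc⟩, hle⟩ := hd
  have hsW := subset_of_mem hW hs
  have hs2 : (W \ s).card = 2 := by rw [Finset.card_sdiff_of_subset hsW]; omega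
  obtain ⟨u, v, huv, hsuv⟩ := Finset.card_eq_two.1 hs2
  have hsd : W \ {u, v} = s := by rw [← hsuv, Finset.sdiff_sdiff_eq_self hsW]
  have huW : u ∈ W := (Finset.mem_sdiff.1 (hsuv ▸ Finset.mem_insert_self u {v})).1
  -- Indicator of the class of `u`: the point itself and its non-neighbours. The cut it defines
  -- contains the pair `{u, v}` omitted by `s`.
  let g : V → ZMod 2 := fun x => if x = u ∨ W \ {u, x} ∉ Y then 1 else 0
  have hcross : ∀ x ∈ W, ∀ y ∈ W, x ≠ y → g x = 1 → g y = 0 → W \ {x, y} ∈ Y := by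
    intro x hx y hy hxy h1 h0
    have h1' : x = u ∨ W \ {u, x} ∉ Y := by
      by_contra h
      simp [g, h] at h1
    have h0' : y ≠ u ∧ W \ {u, y} ∈ Y := by
      by_contra h
      have : y = u ∨ W \ {u, y} ∉ Y := by tauto
      simp [g, this] at h0
    by_cases hxu : x = u
    · exact hxu ▸ h0'.2
    · exact (sdiff_pair_mem_or hW hfree hle hm huW hx hy (Ne.symm hxu) hxy (Ne.symm h0'.1)
        h0'.2).resolve_left (h1'.resolve_left hxu)
  have h01 : ∀ x, g x = 0 ∨ g x = 1 := fun x => by simp only [g]; split_ifs <;> simp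
  have hsup : Y.Supports (FaceChain.ofCompl W 2 fun T => ∑ x ∈ T, g x) := by
    intro σ hσ
    left
    obtain ⟨⟨hσW, hσ2⟩, hne⟩ := ite_ne_right_iff.1 hσ
    obtain ⟨x, y, hxy, hσxy⟩ := Finset.card_eq_two.1 hσ2
    have hx : x ∈ W := (Finset.mem_sdiff.1 (hσxy ▸ Finset.mem_insert_self x {y})).1
    have hy : y ∈ W := (Finset.mem_sdiff.1
      (hσxy ▸ Finset.mem_insert_of_mem (Finset.mem_singleton_self y))).1
    rw [hσxy] at hne
    dsimp only at hne
    rw [Finset.sum_pair hxy] at hne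
    rw [← Finset.sdiff_sdiff_eq_self hσW, hσxy]
    rcases h01 x with h1 | h1 <;> rcases h01 y with h2 | h2
    · simp [h1, h2] at hne
    · rw [Finset.pair_comm]
      exact hcross y hy x hx hxy.symm h2 h1
    · exact hcross x hx y hy hxy h1 h2
    · rw [h1, h2, CharTwo.add_self_eq_zero] at hne
      exact (hne rfl).elim
  have h0 := hY.eq_zero_of_card_eq hle hsup (FaceChain.bdry_ofCompl _ _ _ fun T hT => by
    -- Each point of a triple lies in two of its pairs, so the sum over pairs is even.
    have h : ∀ x ∈ T, ∑ y ∈ T.erase x, g y = ∑ y ∈ T, g y - g x := fun x hx =>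
      eq_sub_of_add_eq (Finset.sum_erase_add T g hx)
    rw [Finset.sum_congr rfl h, Finset.sum_sub_distrib, Finset.sum_const, hT, succ_nsmul,
      add_sub_cancel_right, two_nsmul, CharTwo.add_self_eq_zero]) hsc
  have hgv : g v = 0 := by simp [g, huv.symm, hsd, hs]
  have hgu : g u = 1 := by simp [g]
  simp [FaceChain.ofCompl, hsW, hsuv, huv, hgv, hgu] at h0

end NoFreeFace

end PreAbstractSimplicialComplex

/-! ### The corollary. -/

theorem mainTheorem11 {V : Type*} [Fintype V] (X : PreAbstractSimplicialComplex V) (n : ℕ)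
    (hn : X.vertexSet.ncard = n) (hX : X.IsContractible) :
    (4 ≤ n → ∀ d : ℕ, (n : ℤ) - 3 ≤ (d : ℤ) → ¬ X.GetsStuckAtDim d) ∧
    (∀ (d : ℕ) (Y : PreAbstractSimplicialComplex V),
      (n : ℤ) - 3 ≤ (d : ℤ) → X.GetsStuckAt Y → Y.HasDim d → Y.IsSingleVertex) := by
  classical
  have main : ∀ (d : ℕ) (Y : PreAbstractSimplicialComplex V),
      (n : ℤ) - 3 ≤ (d : ℤ) → X.GetsStuckAt Y → Y.HasDim d → Y.IsSingleVertex := by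
    rintro d Y hd ⟨hXY, hfree⟩ hdim
    have hY := hXY.acyclic hX.acyclic
    let W : Finset V := Finset.univ.filter fun v => {v} ∈ Y
    have hW : ∀ v, v ∈ W ↔ {v} ∈ Y := fun v => by simp [W]
    have hWn : W.card ≤ n := by
      rw [← hn, ← Set.ncard_coe_finset]
      exact Set.ncard_le_ncard (fun v hv => hXY.mem ((hW v).1 hv)) (Set.toFinite _)
    obtain ⟨s, hs, hsc⟩ := hdim.1
    have hle := Finset.card_le_card (PreAbstractSimplicialComplex.subset_of_mem hW hs)
    have h2 := PreAbstractSimplicialComplex.card_ne_add_two hW hfree hdim hY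
    have h3 := PreAbstractSimplicialComplex.card_ne_add_three hW hfree hdim hY
    -- With `d + 1 ≤ |W| ≤ d + 3` and two values excluded, only `|W| = d + 1` remains.
    exact PreAbstractSimplicialComplex.isSingleVertex_of_card_eq hW hfree hdim (by omega)
  refine ⟨fun hn4 d hd => ?_, main⟩
  rintro ⟨Y, hXY, hdim⟩
  obtain ⟨v, hv⟩ := main d Y hd hXY hdim
  obtain ⟨s, hs, hsc⟩ := hdim.1
  rw [(hv s).1 hs, Finset.card_singleton] at hsc
  -- A single vertex has `d = 0`, whereas `n ≥ 4` gives `d ≥ 1`.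
  omega
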